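/- Let $a,b,\eta,c,\rho>0$ and $\delta>1$, and let $f$ be the probability density of a positive random variable. Let $(\Omega,\mathcal F,\mathbb F=(\mathcal F_t)_{t\ge 0},\mathbb P)$ be a filtered probability space with $\mathbb F$ complete and right-continuous, which carries an $\mathbb F$-Poisson random measure $\pi(ds,du,dz)$ on $[0,\infty)\times[0,\infty)\times\mathbb R$ with intensity $ds\,du\,f(z)\,dz$. For every $y\in[b,\infty)$ let $N^y$ be the Hawkes claim-arrival process with intensity $\lambda^y$ started at $y$, and $(Y^y_k)_{k\ge1}$ the claim sizes, all driven by $\pi$: almost surely, for all $t\ge 0$, $$d\lambda^y_t=a(b-\lambda^y_t)\,dt+\eta\,dN^y_t,\quad \lambda^y_0=y,\qquad \sum_{k=1}^{N^y_t}\delta_{Y^y_k}(dz)=\int_{s\in[0,t]}\int_{u\ge0}\mathbf 1_{\{u\le\lambda^y_{s^-}\}}\,\pi(ds,du,dz),$$ so that $N^y$ has $\mathbb F$-intensity $\lambda^y_{t^-}$ and the claim sizes are i.i.d. with density $f$, independent of $N^y$. For $x\in\mathbb R$ put $R^{x,y}_t=x+ct-\sum_{k=1}^{N^y_t}Y^y_k$.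 A strategy $\alpha=(Z,K)$ is a pair of non-decreasing $\mathbb F$-adapted processes, $Z$ càdlàg with $Z_{0^-}=0$ (cumulative dividends) and $K$ càglàd with $K_{0^-}=K_0=0$ (cumulative capital injections). Let $X_t=R^{x,y}_t-Z_t+K_t$, with $X_{0^-}=x$ and $R^{0,y}_{0^-}=0$. The set $\mathcal A(x,y)$ of admissible strategies consists of those for which, almost surely, for all $t\ge0$, $$Z_t-Z_{t^-}\le\bigl(X_{t^-}+R^{0,y}_t-R^{0,y}_{t^-}\bigr)^+.$$ Let $T^\alpha=\inf\{t\ge0:X_{t^+}<0\}$ (with $\inf\emptyset=\infty$) be the ruin time and $$J_\alpha(x,y)=\mathbb E\Bigl[\int_{[0,T^\alpha]}e^{-\rho s}\,dZ_s-\delta\int_{[0,T^\alpha)}e^{-\rho s}\,dK_s\Bigr]\in[-\infty,\infty),\qquad v(x,y)=\sup_{\alpha\in\mathcal A(x,y)}J_\alpha(x,y),$$ where the integrals over infinite horizons are over $[0,\infty)$, jumps at time $0$ are included, and $J_\alpha(x,y)=-\infty$ if the expected discounted injections are infinite. Then for every $x\ge 0$ the map $y\mapsto v(x,y)$ is non-increasing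 on $[b,\infty)$. -/

import Mathlib

open MeasureTheory ProbabilityTheory Set
open scoped NNReal ENNReal

noncomputable section

namespace HawkesDividend

/-- The value `g(t⁻)` of a path on `[0, ∞)` whose value at `0⁻` is `g₀`. -/
def preVal (g₀ : ℝ) (g : ℝ≥0 → ℝ) (t : ℝ≥0) : ℝ :=
  if t = 0 then g₀ else Function.leftLim g t

/-- The extension of a path on `[0, ∞)` to `ℝ` by the value `0` on `(-∞, 0)`, so that a positive
value at time `0` is a jump at time `0`. -/
def extendZero (g : ℝ≥0 → ℝ) (s : ℝ) : ℝ :=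
  if s < 0 then 0 else g s.toNNReal

theorem monotone_extendZero {g : ℝ≥0 → ℝ} (hg : Monotone g) (h0 : 0 ≤ g 0) :
    Monotone (extendZero g) := by
  intro s t hst
  unfold extendZero
  split_ifs with hs ht ht
  · exact le_rfl
  · exact h0.trans (hg bot_le)
  · exact absurd (lt_of_le_of_lt hst ht) hs
  · exact hg (Real.toNNReal_mono hst)

/-- Lebesgue--Stieltjes measure `dg` of a non-decreasing path on `[0, ∞)` with `g(0⁻) = 0`.
The mass of `{t}` is `g(t⁺) - g(t⁻)`. -/
def stieltjesMeasure {g : ℝ≥0 → ℝ} (hg : Monotone g) (h0 : 0 ≤ g 0) : Measure ℝ :=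
  (monotone_extendZero hg h0).stieltjesFunction.measure

variable {Ω : Type*} [mΩ : MeasurableSpace Ω]

/-- The filtration is right-continuous, and complete: its initial σ-algebra contains every
null set. -/
structure UsualConditions (𝓕 : Filtration ℝ≥0 mΩ) (P : Measure Ω) : Prop where
  rightContinuous : 𝓕.IsRightContinuous
  complete : ∀ s : Set Ω, P s = 0 → MeasurableSet[𝓕 0] s

/-- `π` is a Poisson random measure on `[0, ∞) × E` with intensity `m`, relative to the
filtration `𝓕` (the first coordinate is time). -/
structure IsPoissonRandomMeasure {E : Type*} [MeasurableSpace E] (𝓕 : Filtration ℝ≥0 mΩ)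
    (P : Measure Ω) (m : Measure (ℝ≥0 × E)) (π : Ω → Measure (ℝ≥0 × E)) : Prop where
  adapted : ∀ (t : ℝ≥0) (B : Set (ℝ≥0 × E)), MeasurableSet B → B ⊆ Iic t ×ˢ univ →
    Measurable[𝓕 t] (fun ω => π ω B)
  law : ∀ B : Set (ℝ≥0 × E), MeasurableSet B → m B ≠ ∞ →
    P.map (fun ω => π ω B) =
      (poissonMeasure (m B).toNNReal).map (fun n : ℕ => (n : ℝ≥0∞))
  indep_disjoint : ∀ (n : ℕ) (B : Fin n → Set (ℝ≥0 × E)), (∀ i, MeasurableSet (B i)) →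
    Pairwise (fun i j => Disjoint (B i) (B j)) → iIndepFun (fun i ω => π ω (B i)) P
  indep_past : ∀ t : ℝ≥0, Indep (𝓕 t)
    (⨆ B ∈ {B : Set (ℝ≥0 × E) | MeasurableSet B ∧ B ⊆ Ioi t ×ˢ univ},
      MeasurableSpace.comap (fun ω => π ω B) inferInstance) P

/-- `f` is the density of a (strictly) positive random variable. -/
structure IsPositiveDensity (f : ℝ → ℝ) : Prop where
  measurable : Measurable f
  nonneg : ∀ z, 0 ≤ f z
  eq_zero : ∀ z, z ≤ 0 → f z = 0
  lintegral_eq_one : ∫⁻ z, ENNReal.ofReal (f z) = 1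

/-- Lebesgue measure on `[0, ∞)`. -/
def lebesgueHalfLine : Measure ℝ≥0 :=
  (volume : Measure ℝ).comap (fun t : ℝ≥0 => (t : ℝ))

/-- The measure `ds ⊗ du ⊗ f(z) dz` on (time) × (level) × (claim size). -/
def claimIntensity (f : ℝ → ℝ) : Measure (ℝ≥0 × (ℝ≥0 × ℝ)) :=
  lebesgueHalfLine.prod
    (lebesgueHalfLine.prod ((volume : Measure ℝ).withDensity fun z => ENNReal.ofReal (f z)))

/-- The atoms `(s, u, z)` with `s ≤ t` and `u ≤ λ_{s⁻}`, for an intensity path `l = λ` with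
`λ_{0⁻} = y`. -/
def accepted (y : ℝ) (l : ℝ≥0 → ℝ) (t : ℝ≥0) : Set (ℝ≥0 × (ℝ≥0 × ℝ)) :=
  {p | p.1 ≤ t ∧ (p.2.1 : ℝ) ≤ preVal y l p.1}

/-- The claims process driven by `π`, with Hawkes arrivals started at intensity `y`: the counting
process `N`, its intensity `lam`, with
`dλ_t = a (b - λ_t) dt + η dN_t` and `λ_0 = y`, and the size `Y k` of the `(k + 1)`-st claim.
The claims up to time `t` are the atoms of `π` up to `t` that lie below the curve `λ_{s⁻}`:
`∑_{k < N_t} δ_{Y_k}(dz) = ∫_{s ≤ t} ∫ 1_{u ≤ λ_{s⁻}} π(ds, du, dz)`.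
In particular `N` has intensity `λ_{t⁻}` relative to `𝓕`. -/
structure HawkesClaims (𝓕 : Filtration ℝ≥0 mΩ) (P : Measure Ω)
    (π : Ω → Measure (ℝ≥0 × (ℝ≥0 × ℝ))) (a b η y : ℝ) where
  N : ℝ≥0 → Ω → ℕ
  lam : ℝ≥0 → Ω → ℝ
  Y : ℕ → Ω → ℝ
  adapted_N : ∀ t, Measurable[𝓕 t] (N t)
  adapted_lam : ∀ t, Measurable[𝓕 t] (lam t)
  measurable_Y : ∀ k, Measurable (Y k)
  adapted_claims : ∀ t, Measurable[𝓕 t] (fun ω => ∑ k ∈ Finset.range (N t ω), Y k ω)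
  counting : ∀ᵐ ω ∂P, N 0 ω = 0 ∧ Monotone (fun t => N t ω) ∧
    ∀ t, ContinuousWithinAt (fun s => N s ω) (Ici t) t
  intensity : ∀ᵐ ω ∂P, ∀ t : ℝ≥0,
    IntervalIntegrable (fun s : ℝ => lam s.toNNReal ω) volume 0 t ∧
    lam t ω = y + (∫ s in (0 : ℝ)..t, a * (b - lam s.toNNReal ω)) + η * N t ω
  thinning : ∀ᵐ ω ∂P, ∀ t : ℝ≥0,
    ((π ω).restrict (accepted y (fun s => lam s ω) t)).map (fun p => p.2.2) =
      ∑ k ∈ Finset.range (N t ω), Measure.dirac (Y k ω)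

/-- Uncontrolled reserve with initial capital `x`: `R^x_t = x + c t - ∑_{k ≤ N_t} Y_k`. -/
def HawkesClaims.reserve {𝓕 : Filtration ℝ≥0 mΩ} {P : Measure Ω}
    {π : Ω → Measure (ℝ≥0 × (ℝ≥0 × ℝ))} {a b η y : ℝ} (H : HawkesClaims 𝓕 P π a b η y)
    (c x : ℝ) (t : ℝ≥0) (ω : Ω) : ℝ :=
  x + c * t - ∑ k ∈ Finset.range (H.N t ω), H.Y k ω

/-- A pair `(Z, K)` of `𝓕`-adapted non-decreasing processes, `Z` (cumulative dividends) càdlàg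
with `Z_{0⁻} = 0`, and `K` (cumulative capital injections) càglàd with `K_{0⁻} = K_0 = 0`. -/
structure Control (𝓕 : Filtration ℝ≥0 mΩ) where
  Z : ℝ≥0 → Ω → ℝ
  K : ℝ≥0 → Ω → ℝ
  adapted_Z : ∀ t, Measurable[𝓕 t] (Z t)
  adapted_K : ∀ t, Measurable[𝓕 t] (K t)
  mono_Z : ∀ ω, Monotone fun t => Z t ω
  mono_K : ∀ ω, Monotone fun t => K t ω
  rightCont_Z : ∀ ω t, ContinuousWithinAt (fun s => Z s ω) (Ici t) t
  leftCont_K : ∀ ω t, ContinuousWithinAt (fun s => K s ω) (Iic t) t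
  zero_le_Z : ∀ ω, 0 ≤ Z 0 ω
  K_zero : ∀ ω, K 0 ω = 0

namespace Control

variable {𝓕 : Filtration ℝ≥0 mΩ} {P : Measure Ω} {π : Ω → Measure (ℝ≥0 × (ℝ≥0 × ℝ))}
  {a b η y : ℝ}

/-- Controlled surplus `X_t = R^x_t - Z_t + K_t`. -/
def surplus (α : Control 𝓕) (H : HawkesClaims 𝓕 P π a b η y) (c x : ℝ) (t : ℝ≥0) (ω : Ω) : ℝ :=
  H.reserve c x t ω - α.Z t ω + α.K t ω

/-- Dividends are paid out of the available reserve: almost surely, for all `t`,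
`Z_t - Z_{t⁻} ≤ (X_{t⁻} + R^0_t - R^0_{t⁻})⁺`, with `Z_{0⁻} = 0`, `X_{0⁻} = x`, `R^0_{0⁻} = 0`. -/
def Admissible (α : Control 𝓕) (H : HawkesClaims 𝓕 P π a b η y) (c x : ℝ) : Prop :=
  ∀ᵐ ω ∂P, ∀ t : ℝ≥0,
    α.Z t ω - preVal 0 (fun s => α.Z s ω) t ≤
      max 0 (preVal x (fun s => α.surplus H c x s ω) t +
        (H.reserve c 0 t ω - preVal 0 (fun s => H.reserve c 0 s ω) t))

/-- Ruin time `T = inf {t ≥ 0 | X_{t⁺} < 0}`, with `inf ∅ = ∞`. -/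
def ruinTime (α : Control 𝓕) (H : HawkesClaims 𝓕 P π a b η y) (c x : ℝ) (ω : Ω) : ℝ≥0∞ :=
  ⨅ (t : ℝ≥0) (_ : Function.rightLim (fun s => α.surplus H c x s ω) t < 0), (t : ℝ≥0∞)

/-- Discounted dividends `∫_{[0, T]} e^{-ρ s} dZ_s`. -/
def discountedDividends (α : Control 𝓕) (H : HawkesClaims 𝓕 P π a b η y) (c ρ x : ℝ) (ω : Ω) :
    ℝ≥0∞ :=
  ∫⁻ s in {s : ℝ | 0 ≤ s ∧ ENNReal.ofReal s ≤ α.ruinTime H c x ω},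
    ENNReal.ofReal (Real.exp (-ρ * s)) ∂(stieltjesMeasure (α.mono_Z ω) (α.zero_le_Z ω))

/-- Discounted injections `∫_{[0, T)} e^{-ρ s} dK_s`; as `K` is left-continuous, the increment of
`K` up to time `T` is its mass on `[0, T)`. -/
def discountedInjections (α : Control 𝓕) (H : HawkesClaims 𝓕 P π a b η y) (c ρ x : ℝ) (ω : Ω) :
    ℝ≥0∞ :=
  ∫⁻ s in {s : ℝ | 0 ≤ s ∧ ENNReal.ofReal s < α.ruinTime H c x ω},
    ENNReal.ofReal (Real.exp (-ρ * s)) ∂(stieltjesMeasure (α.mono_K ω) (α.K_zero ω).ge)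

/-- Reward `J_α(x, y) = E[∫ e^{-ρ s} dZ_s - δ ∫ e^{-ρ s} dK_s]`, in `[-∞, ∞]`. For an admissible
control and `δ > 1` the integrand is bounded above by a constant, and `J_α = -∞` exactly when the
expected discounted injections are infinite (in `EReal`, `⊤ - ⊤ = ⊥`). -/
def reward (α : Control 𝓕) (H : HawkesClaims 𝓕 P π a b η y) (c ρ δ x : ℝ) : EReal :=
  ((∫⁻ ω, α.discountedDividends H c ρ x ω ∂P : ℝ≥0∞) : EReal) -
    ((ENNReal.ofReal δ * ∫⁻ ω, α.discountedInjections H c ρ x ω ∂P : ℝ≥0∞) : EReal)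

end Control

/-- Value function `v(x, y) = sup {J_α(x, y) | α admissible}`; `y` is the initial intensity
of `H`. -/
def valueFunction {𝓕 : Filtration ℝ≥0 mΩ} {P : Measure Ω}
    {π : Ω → Measure (ℝ≥0 × (ℝ≥0 × ℝ))} {a b η y : ℝ} (H : HawkesClaims 𝓕 P π a b η y)
    (c ρ δ x : ℝ) : EReal :=
  ⨆ (α : Control 𝓕) (_ : α.Admissible H c x), α.reward H c ρ δ x

end HawkesDividend

end

/-! Both claims processes are thinnings of the same atoms of `π`. As long as the intensity started
higher stays above the other one, it accepts every atom accepted by the lower one, so it has at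
least the same jumps; between jumps the gap of the intensities solves a linear equation and keeps
its sign. Hence the intensities stay ordered for all time. Claims being non-negative, the higher
start produces the smaller reserve on almost every path. A strategy that is admissible for the
smaller reserve is transferred to the larger one by stopping it at its ruin time for the smaller
reserve: it remains admissible, is ruined no earlier, keeps all its dividends up to ruin and makes
no more injections than before. -/

open Filter Topology

namespace HawkesDividend

/-! ### Order topology and a linear integral equation -/

/-- Real induction. -/
theorem forall_of_eventually_nhdsGE {X : Type*} [ConditionallyCompleteLinearOrderBot X]
    [TopologicalSpace X] [OrderTopology X] {p : X → Prop}
    (h : ∀ a, (∀ b < a, p b) → ∀ᶠ b in 𝓝[≥] a, p b) (a : X) : p a := by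
  by_contra ha
  have hne : {b | ¬ p b}.Nonempty := ⟨a, ha⟩
  have hbdd : BddBelow {b | ¬ p b} := OrderBot.bddBelow _
  have hbefore : ∀ b < sInf {b | ¬ p b}, p b := fun b hb => not_not.1 (notMem_of_lt_csInf hb hbdd)
  exact (isGLB_csInf hne hbdd).frequently_mem hne ((h _ hbefore).mono fun b hb => not_not.2 hb)

section Dense

variable {X : Type*} [LinearOrder X] [TopologicalSpace X] [OrderTopology X] [DenselyOrdered X]
  {D : Set X} {p : X → Prop} {s t : X}

theorem exists_mem_dense_of_eventually_nhdsGT (hD : Dense D) (hst : s < t)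
    (hp : ∀ᶠ u in 𝓝[>] s, p u) : ∃ q ∈ D, s < q ∧ q < t ∧ p q := by
  obtain ⟨u, hu, hsub⟩ := (mem_nhdsGT_iff_exists_Ioo_subset' hst).1
    (hp.and (Ioo_mem_nhdsGT hst))
  obtain ⟨q, hq, hqu⟩ := hD.exists_between (show s < u from hu)
  exact ⟨q, hq, hqu.1, (hsub hqu).2.2, (hsub hqu).1⟩

theorem exists_mem_dense_of_eventually_nhdsLT (hD : Dense D) (hst : s < t)
    (hp : ∀ᶠ u in 𝓝[<] t, p u) : ∃ q ∈ D, s < q ∧ q < t ∧ p q := by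
  obtain ⟨u, hu, hsub⟩ := (mem_nhdsLT_iff_exists_Ioo_subset' hst).1
    (hp.and (Ioo_mem_nhdsLT hst))
  obtain ⟨q, hq, hqu⟩ := hD.exists_between (show u < t from hu)
  exact ⟨q, hq, (hsub hqu).2.1, hqu.2, (hsub hqu).1⟩

end Dense

theorem eventually_nhdsLT_eq_of_monotone_nat {X : Type*} [LinearOrder X] [TopologicalSpace X]
    [OrderTopology X] {N : X → ℕ} (hN : Monotone N) {t : X} (ht : (Iio t).Nonempty) :
    ∃ n, ∀ᶠ s in 𝓝[<] t, N s = n := by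
  have hbdd : BddAbove (N '' Iio t) :=
    ⟨N t, forall_mem_image.2 fun s hs => hN (le_of_lt hs)⟩
  obtain ⟨r, hr, hmax⟩ := Nat.sSup_mem (ht.image N) hbdd
  refine ⟨N r, ?_⟩
  filter_upwards [Ioo_mem_nhdsLT (show r < t from hr)] with s hs
  exact le_antisymm (hmax ▸ le_csSup hbdd ⟨s, hs.2, rfl⟩) (hN hs.1.le)

theorem eventually_nhdsWithin_eq_of_discrete {X Y : Type*} [TopologicalSpace X]
    [TopologicalSpace Y] [DiscreteTopology Y] {N : X → Y} {S : Set X} {t : X}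
    (hN : ContinuousWithinAt N S t) : ∀ᶠ s in 𝓝[S] t, N s = N t := by
  rwa [ContinuousWithinAt, nhds_discrete, tendsto_pure] at hN

theorem eq_mul_exp_of_eq_sub_integral {g : ℝ → ℝ} {k r t : ℝ}
    (hg : IntervalIntegrable g volume r t)
    (h : ∀ s ∈ Icc r t, g s = g r - k * ∫ u in r..s, g u) {s : ℝ} (hs : s ∈ Icc r t) :
    g s = g r * Real.exp (-k * (s - r)) := by
  have hrt : r ≤ t := hs.1.trans hs.2
  have hG : ContinuousOn (fun s => ∫ u in r..s, g u) (Icc r t) :=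
    uIcc_of_le hrt ▸ intervalIntegral.continuousOn_primitive_interval' hg left_mem_uIcc
  have hgc : ContinuousOn g (Icc r t) := (continuousOn_const.sub (hG.const_mul k)).congr h
  have hderiv : ∀ s ∈ Ico r t, HasDerivWithinAt
      (fun s => Real.exp (k * (s - r)) * (g r - k * ∫ u in r..s, g u)) 0 (Ici s) s := by
    intro s hs
    have hIcc : Icc r t ∈ 𝓝[>] s := Icc_mem_nhdsGT_of_mem hs
    have hG' : HasDerivWithinAt (fun s => ∫ u in r..s, g u) (g s) (Ici s) s :=
      intervalIntegral.integral_hasDerivWithinAt_right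
        (hg.mono_set (uIcc_subset_uIcc_left (Icc_subset_uIcc ⟨hs.1, hs.2.le⟩)))
        ⟨_, hIcc, hgc.aestronglyMeasurable measurableSet_Icc⟩
        ((hgc s ⟨hs.1, hs.2.le⟩).mono_of_mem_nhdsWithin hIcc)
    have hexp : HasDerivWithinAt (fun s => Real.exp (k * (s - r)))
        (Real.exp (k * (s - r)) * k) (Ici s) s := by
      simpa using ((((hasDerivAt_id s).sub_const r).const_mul k).exp).hasDerivWithinAt
    refine (hexp.mul ((hG'.const_mul k).const_sub (g r))).congr_deriv ?_
    rw [h s ⟨hs.1, hs.2.le⟩]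
    ring
  have hconst : Real.exp (k * (s - r)) * g s = g r := by
    simpa [← h s hs] using constant_of_has_deriv_right_zero (by fun_prop) hderiv s hs
  rw [← hconst, mul_right_comm, ← Real.exp_add]
  simp

/-! ### Comparison of claim paths -/

/-- A realisation of `HawkesClaims`: arrivals `N`, intensity `l` and claim sizes `Y` obtained by
thinning the deterministic configuration `μ` of atoms. The comparison of claims processes is
carried out path by path on such realisations. -/
structure IsClaimPath (μ : Measure (ℝ≥0 × (ℝ≥0 × ℝ))) (a b η y : ℝ) (N : ℝ≥0 → ℕ)
    (l : ℝ≥0 → ℝ) (Y : ℕ → ℝ) : Prop where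
  N_zero : N 0 = 0
  mono : Monotone N
  rightCont : ∀ t, ContinuousWithinAt N (Ici t) t
  integrable : ∀ t : ℝ≥0, IntervalIntegrable (fun s : ℝ => l s.toNNReal) volume 0 t
  intensity : ∀ t : ℝ≥0, l t = y + (∫ s in (0 : ℝ)..t, a * (b - l s.toNNReal)) + η * N t
  thinning : ∀ t : ℝ≥0, (μ.restrict (accepted y l t)).map (fun p => p.2.2) =
      ∑ k ∈ Finset.range (N t), Measure.dirac (Y k)

theorem accepted_inter_Iic (y : ℝ) (l : ℝ≥0 → ℝ) {r t : ℝ≥0} (hrt : r ≤ t) :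
    accepted y l t ∩ Iic r ×ˢ univ = accepted y l r := by
  ext p
  simp only [accepted, mem_inter_iff, mem_ofPred_eq, mem_prod, mem_Iic, mem_univ, and_true]
  exact ⟨fun h => ⟨h.2, h.1.2⟩, fun h => ⟨⟨h.1.trans hrt, h.2⟩, h.1⟩⟩

theorem accepted_subset_accepted {y y' : ℝ} {l l' : ℝ≥0 → ℝ} {t : ℝ≥0}
    (h : ∀ s ≤ t, preVal y l s ≤ preVal y' l' s) : accepted y l t ⊆ accepted y' l' t :=
  fun p hp => ⟨hp.1, hp.2.trans (h p.1 hp.1)⟩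

theorem sum_le_sum_of_sum_dirac_le {ι κ : Type*} {s : Finset ι} {t : Finset κ} {u : ι → ℝ}
    {v : κ → ℝ} (hv : ∀ k ∈ t, 0 ≤ v k)
    (h : ∑ i ∈ s, Measure.dirac (u i) ≤ ∑ k ∈ t, Measure.dirac (v k)) :
    ∑ i ∈ s, u i ≤ ∑ k ∈ t, v k := by
  have hle := lintegral_mono' h (le_refl ENNReal.ofReal)
  simp only [lintegral_finsetSum_measure, lintegral_dirac] at hle
  rw [← ENNReal.ofReal_sum_of_nonneg hv] at hle
  refine (Finset.sum_le_sum fun i _ => le_max_left (u i) 0).trans ?_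
  rw [← ENNReal.ofReal_le_ofReal_iff (Finset.sum_nonneg hv),
    ENNReal.ofReal_sum_of_nonneg fun i _ => le_max_right (u i) 0]
  simpa only [ENNReal.ofReal_max, ENNReal.ofReal_zero, max_zero] using hle

namespace IsClaimPath

variable {μ : Measure (ℝ≥0 × (ℝ≥0 × ℝ))} {a b η y y' : ℝ} {N N' : ℝ≥0 → ℕ} {l l' : ℝ≥0 → ℝ}
  {Y Y' : ℕ → ℝ}

theorem intervalIntegrable (h : IsClaimPath μ a b η y N l Y) (s t : ℝ≥0) :
    IntervalIntegrable (fun s : ℝ => l s.toNNReal) volume s t :=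
  (h.integrable s).symm.trans (h.integrable t)

theorem tendsto_integral (h : IsClaimPath μ a b η y N l Y) (t : ℝ≥0) :
    Tendsto (fun r : ℝ≥0 => ∫ s in (t : ℝ)..r, l s.toNNReal) (𝓝[<] t) (𝓝 0) := by
  have hc : ContinuousOn (fun r => ∫ s in (t : ℝ)..r, l s.toNNReal) (uIcc 0 t) :=
    intervalIntegral.continuousOn_primitive_interval' (h.integrable t) right_mem_uIcc
  have hcoe : Tendsto ((↑) : ℝ≥0 → ℝ) (𝓝[<] t) (𝓝[uIcc 0 (t : ℝ)] t) :=
    tendsto_nhdsWithin_of_tendsto_nhds_of_eventually_within _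
      (NNReal.continuous_coe.continuousAt.mono_left nhdsWithin_le_nhds)
      (eventually_nhdsWithin_of_forall fun r hr =>
        Icc_subset_uIcc ⟨r.2, NNReal.coe_le_coe.2 (le_of_lt hr)⟩)
  simpa [Function.comp_def] using (hc t right_mem_uIcc).tendsto.comp hcoe

theorem intensity_eq_add (h : IsClaimPath μ a b η y N l Y) (r t : ℝ≥0) :
    l t = l r + a * (b * (t - r) - ∫ s in (r : ℝ)..t, l s.toNNReal) + η * ((N t : ℝ) - N r) := by
  have hdrift : ∀ t : ℝ≥0, IntervalIntegrable (fun s : ℝ => a * (b - l s.toNNReal)) volume 0 t :=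
    fun t => (intervalIntegrable_const.sub (h.integrable t)).const_mul a
  have hincrement : ∫ s in (r : ℝ)..t, a * (b - l s.toNNReal) =
      a * (b * (t - r) - ∫ s in (r : ℝ)..t, l s.toNNReal) := by
    rw [intervalIntegral.integral_const_mul, intervalIntegral.integral_sub
      intervalIntegrable_const (h.intervalIntegrable r t), intervalIntegral.integral_const,
      smul_eq_mul, mul_comm b]
  rw [← hincrement, ← intervalIntegral.integral_interval_sub_left (hdrift t) (hdrift r),
    h.intensity t, h.intensity r]
  ring

theorem intensity_gap_eq (h : IsClaimPath μ a b η y N l Y) (h' : IsClaimPath μ a b η y' N' l' Y')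
    (r t : ℝ≥0) : l' t - l t = (l' r - l r) -
      a * (∫ s in (r : ℝ)..t, (l' s.toNNReal - l s.toNNReal)) +
        η * ((N' t - N t : ℝ) - (N' r - N r)) := by
  rw [intervalIntegral.integral_sub (h'.intervalIntegrable r t) (h.intervalIntegrable r t)]
  linarith [h.intensity_eq_add r t, h'.intensity_eq_add r t]

theorem tendsto_leftLim (h : IsClaimPath μ a b η y N l Y) {t : ℝ≥0} (ht : 0 < t) :
    Tendsto l (𝓝[<] t) (𝓝 (Function.leftLim l t)) := by
  refine tendsto_leftLim_of_tendsto ?_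
  obtain ⟨n, hn⟩ := eventually_nhdsLT_eq_of_monotone_nat h.mono ⟨0, ht⟩
  have hid : Tendsto ((↑) : ℝ≥0 → ℝ) (𝓝[<] t) (𝓝 t) :=
    NNReal.continuous_coe.continuousAt.mono_left nhdsWithin_le_nhds
  refine ⟨_, Tendsto.congr' ?_ ((((hid.sub_const (t : ℝ)).const_mul b).sub
    (h.tendsto_integral t)).const_mul a |>.const_add (l t) |>.add_const (η * ((n : ℝ) - N t)))⟩
  filter_upwards [hn] with r hr
  rw [h.intensity_eq_add t r, hr]

theorem measure_accepted (h : IsClaimPath μ a b η y N l Y) (t : ℝ≥0) :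
    μ (accepted y l t) = N t := by
  have hmass := congrArg (fun ν => ν univ) (h.thinning t)
  simpa [Measure.map_apply (show Measurable fun p : ℝ≥0 × (ℝ≥0 × ℝ) => p.2.2 by fun_prop)
    MeasurableSet.univ] using hmass

theorem preVal_le (h : IsClaimPath μ a b η y N l Y) (h' : IsClaimPath μ a b η y' N' l' Y')
    (hy : y ≤ y') {t : ℝ≥0} (hl : ∀ s < t, l s ≤ l' s) : preVal y l t ≤ preVal y' l' t := by
  unfold preVal
  split_ifs with ht
  · exact hy
  · have ht : 0 < t := pos_iff_ne_zero.2 ht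
    have : (𝓝[<] t).NeBot := nhdsLT_neBot_of_exists_lt ⟨0, ht⟩
    exact le_of_tendsto_of_tendsto (h.tendsto_leftLim ht) (h'.tendsto_leftLim ht)
      (eventually_nhdsWithin_of_forall hl)

theorem arrivals_add_le_add (h : IsClaimPath μ a b η y N l Y)
    (h' : IsClaimPath μ a b η y' N' l' Y') {r t : ℝ≥0} (hrt : r ≤ t)
    (hl : ∀ s ≤ t, preVal y l s ≤ preVal y' l' s) : N t + N' r ≤ N r + N' t := by
  have hm : MeasurableSet (Iic r ×ˢ univ : Set (ℝ≥0 × (ℝ≥0 × ℝ))) :=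
    measurableSet_Iic.prod MeasurableSet.univ
  have split := measure_inter_add_sdiff (μ := μ) (accepted y l t) hm
  have split' := measure_inter_add_sdiff (μ := μ) (accepted y' l' t) hm
  rw [accepted_inter_Iic y l hrt, h.measure_accepted, h.measure_accepted] at split
  rw [accepted_inter_Iic y' l' hrt, h'.measure_accepted, h'.measure_accepted] at split'
  suffices ((N t + N' r : ℕ) : ℝ≥0∞) ≤ (N r + N' t : ℕ) by exact_mod_cast this
  push_cast
  rw [← split, ← split', add_right_comm, ← add_assoc]
  gcongr
  exact accepted_subset_accepted hl

theorem intensity_le_of_forall_lt (h : IsClaimPath μ a b η y N l Y)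
    (h' : IsClaimPath μ a b η y' N' l' Y') (hη : 0 ≤ η) (hy : y ≤ y') {t : ℝ≥0}
    (hl : ∀ s < t, l s ≤ l' s) : l t ≤ l' t := by
  rcases eq_or_ne t 0 with rfl | ht
  · simpa [h.intensity 0, h'.intensity 0, h.N_zero, h'.N_zero] using hy
  have : (𝓝[<] t).NeBot := nhdsLT_neBot_of_exists_lt ⟨0, pos_iff_ne_zero.2 ht⟩
  have hdrift : Tendsto (fun r : ℝ≥0 => a * ∫ s in (t : ℝ)..r, (l' s.toNNReal - l s.toNNReal))
      (𝓝[<] t) (𝓝 0) := by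
    simp only [intervalIntegral.integral_sub (h'.intervalIntegrable t _)
      (h.intervalIntegrable t _)]
    simpa using ((h'.tendsto_integral t).sub (h.tendsto_integral t)).const_mul a
  -- Up to the drift, which vanishes as `r ↑ t`, the gap `l' - l` does not decrease from `r` to `t`,
  -- because every atom in `(r, t]` that makes `l` jump also makes `l'` jump.
  refine sub_nonneg.1 (le_of_tendsto hdrift (eventually_nhdsWithin_of_forall fun r hr => ?_))
  have harrivals : (N t + N' r : ℝ) ≤ N r + N' t := by
    exact_mod_cast h.arrivals_add_le_add h' (le_of_lt hr) fun s hs =>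
      h.preVal_le h' hy fun q hq => hl q (hq.trans_le hs)
  have hjump : η * ((N' r - N r : ℝ) - (N' t - N t)) ≤ 0 :=
    mul_nonpos_of_nonneg_of_nonpos hη (by linarith)
  linarith [h.intensity_gap_eq h' t r, hl r hr]

theorem intensity_le_of_no_arrivals (h : IsClaimPath μ a b η y N l Y)
    (h' : IsClaimPath μ a b η y' N' l' Y') {r t : ℝ≥0} (hrt : r ≤ t) (hN : N t = N r)
    (hN' : N' t = N' r) (hl : l r ≤ l' r) : l t ≤ l' t := by
  have hode : ∀ s ∈ Icc (r : ℝ) t, l' s.toNNReal - l s.toNNReal =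
      (l' (r : ℝ).toNNReal - l (r : ℝ).toNNReal) -
        a * ∫ u in (r : ℝ)..s, (l' u.toNNReal - l u.toNNReal) := by
    intro s hs
    lift s to ℝ≥0 using r.2.trans hs.1
    have hrs : r ≤ s := NNReal.coe_le_coe.1 hs.1
    have hst : s ≤ t := NNReal.coe_le_coe.1 hs.2
    have hNs : N s = N r := le_antisymm (hN ▸ h.mono hst) (h.mono hrs)
    have hNs' : N' s = N' r := le_antisymm (hN' ▸ h'.mono hst) (h'.mono hrs)
    simp only [Real.toNNReal_coe]
    rw [h.intensity_gap_eq h' r s, hNs, hNs', sub_self, mul_zero, add_zero]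
  have hsol := eq_mul_exp_of_eq_sub_integral
    ((h'.intervalIntegrable r t).sub (h.intervalIntegrable r t)) hode
    (right_mem_Icc.2 (NNReal.coe_le_coe.2 hrt))
  simp only [Real.toNNReal_coe] at hsol
  exact sub_nonneg.1 (hsol ▸ mul_nonneg (sub_nonneg.2 hl) (Real.exp_pos _).le)

theorem intensity_le (h : IsClaimPath μ a b η y N l Y) (h' : IsClaimPath μ a b η y' N' l' Y')
    (hη : 0 ≤ η) (hy : y ≤ y') (t : ℝ≥0) : l t ≤ l' t := by
  refine forall_of_eventually_nhdsGE (p := fun t => l t ≤ l' t) (fun r hr => ?_) t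
  filter_upwards [eventually_nhdsWithin_eq_of_discrete (h.rightCont r),
    eventually_nhdsWithin_eq_of_discrete (h'.rightCont r), self_mem_nhdsWithin] with s hN hN' hrs
  exact h.intensity_le_of_no_arrivals h' hrs hN hN' (h.intensity_le_of_forall_lt h' hη hy hr)

theorem claim_nonneg (h : IsClaimPath μ a b η y N l Y) (hμ : μ {p | p.2.2 < 0} = 0) {t : ℝ≥0}
    {k : ℕ} (hk : k ∈ Finset.range (N t)) : 0 ≤ Y k := by
  by_contra! hneg
  have hnull : ((μ.restrict (accepted y l t)).map (fun p => p.2.2)) (Iio 0) = 0 := by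
    rw [Measure.map_apply (by fun_prop) measurableSet_Iio]
    exact le_antisymm ((Measure.restrict_apply_le _ _).trans hμ.le) bot_le
  rw [h.thinning t, Measure.finsetSum_apply] at hnull
  simpa [hneg] using Finset.sum_eq_zero_iff.1 hnull k hk

theorem sum_claims_le (h : IsClaimPath μ a b η y N l Y) (h' : IsClaimPath μ a b η y' N' l' Y')
    (hη : 0 ≤ η) (hy : y ≤ y') (hμ : μ {p | p.2.2 < 0} = 0) (t : ℝ≥0) :
    ∑ k ∈ Finset.range (N t), Y k ≤ ∑ k ∈ Finset.range (N' t), Y' k := by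
  refine sum_le_sum_of_sum_dirac_le (fun k hk => h'.claim_nonneg hμ hk) ?_
  rw [← h.thinning t, ← h'.thinning t]
  exact Measure.map_mono (Measure.restrict_mono_set μ (accepted_subset_accepted fun s _ =>
    h.preVal_le h' hy fun q _ => h.intensity_le h' hη hy q)) (by fun_prop)

end IsClaimPath

/-! ### Null sets of Poisson random measures -/

theorem poissonMeasure_zero : poissonMeasure 0 = Measure.dirac 0 := by
  refine Measure.ext_of_singleton fun n => ?_
  rcases eq_or_ne n 0 with rfl | hn <;> simp [poissonMeasure_singleton, *]

theorem IsPoissonRandomMeasure.ae_eq_zero {Ω E : Type*} [mΩ : MeasurableSpace Ω]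
    [MeasurableSpace E] {𝓕 : Filtration ℝ≥0 mΩ} {P : Measure Ω} {m : Measure (ℝ≥0 × E)}
    {π : Ω → Measure (ℝ≥0 × E)} (hπ : IsPoissonRandomMeasure 𝓕 P m π) {B : Set (ℝ≥0 × E)}
    (hB : MeasurableSet B) (hm : m B = 0) : ∀ᵐ ω ∂P, π ω B = 0 := by
  have hlaw : P.map (fun ω => π ω B) = Measure.dirac 0 := by
    rw [hπ.law B hB (by simp [hm]), hm, ENNReal.toNNReal_zero, poissonMeasure_zero,
      Measure.map_dirac' measurable_from_nat, Nat.cast_zero]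
  have hmeas : AEMeasurable (fun ω => π ω B) P :=
    .of_map_ne_zero (hlaw ▸ NeZero.ne (Measure.dirac 0))
  refine ae_of_ae_map (p := (· = 0)) hmeas ?_
  rw [hlaw, ae_dirac_eq]
  rfl

theorem claimIntensity_neg {f : ℝ → ℝ} (hf : ∀ z < 0, f z = 0) :
    claimIntensity f {p | p.2.2 < 0} = 0 := by
  have : SigmaFinite lebesgueHalfLine := by
    have hcoe : MeasurableEmbedding ((↑) : ℝ≥0 → ℝ) := .subtype_coe measurableSet_Ici
    refine SigmaFinite.of_map _ hcoe.measurable.aemeasurable ?_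
    rw [lebesgueHalfLine, hcoe.map_comap]
    infer_instance
  have hdensity : (volume.withDensity fun z => ENNReal.ofReal (f z)) (Iio 0) = 0 := by
    rw [withDensity_apply _ measurableSet_Iio]
    exact (setLIntegral_congr_fun measurableSet_Iio fun z hz => by simp [hf z hz]).trans
      lintegral_zero
  have hprod : {p : ℝ≥0 × (ℝ≥0 × ℝ) | p.2.2 < 0} = univ ×ˢ (univ ×ˢ Iio 0) := by
    ext p
    simp
  rw [hprod, claimIntensity, Measure.prod_prod, Measure.prod_prod, hdensity, mul_zero, mul_zero]

/-! ### Stopped paths -/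

/-- The time `t ∧ T` in `[0, ∞)`, where `T` may be infinite. -/
noncomputable def clip (T : ℝ≥0∞) (t : ℝ≥0) : ℝ≥0 := (min (t : ℝ≥0∞) T).toNNReal

section Clip

variable {T : ℝ≥0∞} {t : ℝ≥0} {g : ℝ≥0 → ℝ}

theorem coe_clip (T : ℝ≥0∞) (t : ℝ≥0) : (clip T t : ℝ≥0∞) = min (t : ℝ≥0∞) T :=
  ENNReal.coe_toNNReal (min_lt_of_left_lt ENNReal.coe_lt_top).ne

theorem clip_of_le (h : t ≤ T) : clip T t = t := by simp [clip, h]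

theorem clip_of_ge (h : T ≤ t) : clip T t = T.toNNReal := by simp [clip, h]

theorem clip_le (T : ℝ≥0∞) (t : ℝ≥0) : clip T t ≤ t :=
  ENNReal.coe_le_coe.1 ((coe_clip T t).trans_le (min_le_left _ _))

theorem clip_top : clip ∞ = id := funext fun _ => clip_of_le le_top

theorem clip_coe (r t : ℝ≥0) : clip r t = min t r :=
  ENNReal.coe_injective (by rw [coe_clip, ENNReal.coe_min])

theorem monotone_clip (T : ℝ≥0∞) : Monotone (clip T) := fun s t hst => by
  rw [← ENNReal.coe_le_coe, coe_clip, coe_clip]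
  exact min_le_min_right T (ENNReal.coe_le_coe.2 hst)

theorem continuous_clip (T : ℝ≥0∞) : Continuous (clip T) :=
  ENNReal.continuousOn_toNNReal.comp_continuous (by fun_prop)
    fun _ => (min_lt_of_left_lt ENNReal.coe_lt_top).ne

theorem preVal_comp_clip_of_le (hg : Monotone g) (g₀ : ℝ) (h : t ≤ T) :
    preVal g₀ (g ∘ clip T) t = preVal g₀ g t := by
  unfold preVal
  split_ifs with ht
  · rfl
  · have : (𝓝[<] t).NeBot := nhdsLT_neBot_of_exists_lt ⟨0, pos_iff_ne_zero.2 ht⟩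
    refine leftLim_eq_of_tendsto ((hg.tendsto_leftLim t).congr' ?_)
    filter_upwards [self_mem_nhdsWithin] with s hs
    rw [Function.comp_apply, clip_of_le ((ENNReal.coe_le_coe.2 (le_of_lt hs)).trans h)]

theorem preVal_comp_clip_of_gt (g : ℝ≥0 → ℝ) (g₀ : ℝ) (h : T < t) :
    preVal g₀ (g ∘ clip T) t = g T.toNNReal := by
  lift T to ℝ≥0 using h.ne_top
  have hTt : T < t := ENNReal.coe_lt_coe.1 h
  have : (𝓝[<] t).NeBot := nhdsLT_neBot_of_exists_lt ⟨T, hTt⟩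
  rw [preVal, if_neg (pos_of_gt hTt).ne']
  refine leftLim_eq_of_tendsto (tendsto_const_nhds.congr' ?_)
  filter_upwards [Ioo_mem_nhdsLT hTt] with s hs
  rw [Function.comp_apply, clip_of_ge (ENNReal.coe_le_coe.2 hs.1.le)]

theorem rightLim_comp_clip_of_lt (hg : Monotone g) (h : t < T) :
    Function.rightLim (g ∘ clip T) t = Function.rightLim g t := by
  refine rightLim_eq_of_tendsto ((hg.tendsto_rightLim t).congr' ?_)
  have hlt : ∀ᶠ s : ℝ≥0 in 𝓝 t, (s : ℝ≥0∞) < T :=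
    ENNReal.continuous_coe.continuousAt.eventually_lt_const h
  filter_upwards [nhdsWithin_le_nhds hlt] with s hs
  rw [Function.comp_apply, clip_of_le hs.le]

theorem comp_clip_lt_iff (hg : Monotone g) (hc : ∀ t, ContinuousWithinAt g (Ici t) t)
    {D : Set ℝ≥0} (hD : Dense D) {z : ℝ} :
    g (clip T t) < z ↔ g t < z ∨ ∃ q, (q ∈ D ∧ q < t) ∧ T < q ∧ g q < z := by
  constructor
  · intro hz
    rcases le_or_gt (t : ℝ≥0∞) T with hle | hlt
    · exact .inl (by rwa [clip_of_le hle] at hz)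
    · lift T to ℝ≥0 using hlt.ne_top
      rw [clip_of_ge hlt.le] at hz
      obtain ⟨q, hq, hTq, hqt, hqz⟩ := exists_mem_dense_of_eventually_nhdsGT hD
        (ENNReal.coe_lt_coe.1 hlt) (((hc T).mono_left
          (nhdsWithin_mono T Ioi_subset_Ici_self)).eventually_lt_const hz)
      exact .inr ⟨q, ⟨hq, hqt⟩, ENNReal.coe_lt_coe.2 hTq, hqz⟩
  · rintro (hz | ⟨q, -, hTq, hqz⟩)
    · exact (hg (clip_le T t)).trans_lt hz
    · exact (hg (ENNReal.coe_le_coe.1 ((coe_clip T t).trans_le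
        ((min_le_right _ _).trans hTq.le)))).trans_lt hqz

theorem lt_comp_clip_iff (hg : Monotone g) (hc : ∀ t, ContinuousWithinAt g (Iic t) t)
    {D : Set ℝ≥0} (hD : Dense D) {z : ℝ} :
    z < g (clip T t) ↔ ∃ q, (q ∈ insert 0 (insert t D) ∧ q ≤ t) ∧ q ≤ T ∧ z < g q := by
  constructor
  · intro hz
    rcases le_or_gt (t : ℝ≥0∞) T with hle | hlt
    · exact ⟨t, ⟨by simp, le_rfl⟩, hle, by rwa [clip_of_le hle] at hz⟩
    · lift T to ℝ≥0 using hlt.ne_top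
      rw [clip_of_ge hlt.le, ENNReal.toNNReal_coe] at hz
      rcases eq_or_ne T 0 with rfl | hT
      · exact ⟨0, ⟨by simp, bot_le⟩, bot_le, hz⟩
      · obtain ⟨q, hq, -, hqT, hqz⟩ := exists_mem_dense_of_eventually_nhdsLT hD
          (pos_iff_ne_zero.2 hT) (((hc T).mono_left
            (nhdsWithin_mono T Iio_subset_Iic_self)).eventually_const_lt hz)
        exact ⟨q, ⟨by simp [hq], (hqT.trans (ENNReal.coe_lt_coe.1 hlt)).le⟩,
          ENNReal.coe_le_coe.2 hqT.le, hqz⟩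
  · rintro ⟨q, ⟨-, hqt⟩, hqT, hqz⟩
    refine hqz.trans_le (hg (ENNReal.coe_le_coe.1 ?_))
    rw [coe_clip]
    exact le_min (ENNReal.coe_le_coe.2 hqt) hqT

end Clip

section StoppedMeasure

variable {f : ℝ → ℝ} {r : ℝ}

theorem monotone_comp_min (hf : Monotone f) (r : ℝ) : Monotone fun s => f (min s r) :=
  fun _ _ hst => hf (min_le_min_right r hst)

theorem rightLim_comp_min (hf : Monotone f) (hr : ContinuousWithinAt f (Ici r) r) (s : ℝ) :
    Function.rightLim (fun s => f (min s r)) s = Function.rightLim f (min s r) := by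
  refine rightLim_eq_of_tendsto ?_
  rcases lt_or_ge s r with hsr | hrs
  · rw [min_eq_left hsr.le]
    refine (hf.tendsto_rightLim s).congr' ?_
    filter_upwards [Ioo_mem_nhdsGT hsr] with u hu
    rw [min_eq_left hu.2.le]
  · rw [min_eq_right hrs, hr.rightLim_eq]
    refine tendsto_const_nhds.congr' ?_
    filter_upwards [self_mem_nhdsWithin] with u hu
    rw [min_eq_right (hrs.trans (le_of_lt hu))]

theorem leftLim_comp_min (hf : Monotone f) (hr : ContinuousWithinAt f (Iic r) r) (s : ℝ) :
    Function.leftLim (fun s => f (min s r)) s = Function.leftLim f (min s r) := by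
  refine leftLim_eq_of_tendsto ?_
  rcases le_or_gt s r with hsr | hrs
  · rw [min_eq_left hsr]
    refine (hf.tendsto_leftLim s).congr' ?_
    filter_upwards [self_mem_nhdsWithin] with u hu
    rw [min_eq_left ((le_of_lt hu).trans hsr)]
  · rw [min_eq_right hrs.le, hr.leftLim_eq]
    refine tendsto_const_nhds.congr' ?_
    filter_upwards [Ioo_mem_nhdsLT hrs] with u hu
    rw [min_eq_right hu.1.le]

theorem ofReal_sub_comp_min (hf : Monotone f) (u v r : ℝ) :
    ENNReal.ofReal (f (min v r) - f (min u r)) = ENNReal.ofReal (f (min v r) - f u) := by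
  rcases le_total u r with hur | hru
  · rw [min_eq_left hur]
  · rw [min_eq_right hru,
      ENNReal.ofReal_of_nonpos (sub_nonpos.2 (hf (min_le_right _ _))),
      ENNReal.ofReal_of_nonpos (sub_nonpos.2 (hf ((min_le_right _ _).trans hru)))]

theorem measure_stieltjes_comp_min_of_rightCont (hf : Monotone f)
    (hr : ContinuousWithinAt f (Ici r) r) :
    (monotone_comp_min hf r).stieltjesFunction.measure =
      hf.stieltjesFunction.measure.restrict (Iic r) := by
  refine Measure.ext_of_Ioc _ _ fun u v _ => ?_
  rw [Measure.restrict_apply measurableSet_Ioc, Ioc_inter_Iic, StieltjesFunction.measure_Ioc,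
    StieltjesFunction.measure_Ioc]
  simp only [Monotone.stieltjesFunction_eq, rightLim_comp_min hf hr]
  exact ofReal_sub_comp_min hf.rightLim u v r

theorem leftLim_stieltjesFunction (hf : Monotone f) (s : ℝ) :
    Function.leftLim hf.stieltjesFunction s = Function.leftLim f s := by
  rw [funext hf.stieltjesFunction_eq, leftLim_rightLim (hf.tendsto_leftLim s)]

theorem measure_stieltjes_comp_min_of_leftCont (hf : Monotone f)
    (hr : ContinuousWithinAt f (Iic r) r) :
    (monotone_comp_min hf r).stieltjesFunction.measure =
      hf.stieltjesFunction.measure.restrict (Iio r) := by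
  refine Measure.ext_of_Ico _ _ fun u v _ => ?_
  rw [Measure.restrict_apply measurableSet_Ico, Ico_inter_Iio, StieltjesFunction.measure_Ico,
    StieltjesFunction.measure_Ico]
  simp only [leftLim_stieltjesFunction, leftLim_comp_min hf hr]
  exact ofReal_sub_comp_min hf.leftLim u v r

end StoppedMeasure

section StoppedStieltjes

variable {g : ℝ≥0 → ℝ}

theorem extendZero_comp_clip_coe (g : ℝ≥0 → ℝ) (r : ℝ≥0) :
    extendZero (g ∘ clip r) = fun s => extendZero g (min s r) := by
  funext s
  rcases lt_or_ge s 0 with hs | hs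
  · simp [extendZero, hs]
  · lift s to ℝ≥0 using hs
    simp [extendZero, clip_coe, ← NNReal.coe_min]

theorem continuousWithinAt_Ici_extendZero {r : ℝ≥0} (hg : ContinuousWithinAt g (Ici r) r) :
    ContinuousWithinAt (extendZero g) (Ici (r : ℝ)) r := by
  have hcomp : ContinuousWithinAt (g ∘ Real.toNNReal) (Ici (r : ℝ)) r :=
    ContinuousWithinAt.comp (t := Ici r) (by simpa using hg)
      continuous_real_toNNReal.continuousWithinAt fun s hs => NNReal.le_toNNReal_of_coe_le hs
  exact hcomp.congr (fun s hs => if_neg (not_lt.2 (r.2.trans hs))) (if_neg (not_lt.2 r.2))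

theorem continuousWithinAt_Iic_extendZero (h0 : g 0 = 0) {r : ℝ≥0}
    (hg : ContinuousWithinAt g (Iic r) r) :
    ContinuousWithinAt (extendZero g) (Iic (r : ℝ)) r := by
  have heq : extendZero g = g ∘ Real.toNNReal := by
    funext s
    unfold extendZero
    split_ifs with hs
    · rw [Function.comp_apply, Real.toNNReal_of_nonpos hs.le, h0]
    · rfl
  rw [heq]
  exact ContinuousWithinAt.comp (t := Iic r) (by simpa using hg)
    continuous_real_toNNReal.continuousWithinAt fun s hs => Real.toNNReal_le_iff_le_coe.2 hs

theorem stieltjesMeasure_comp_clip_of_rightCont (hg : Monotone g) (h0 : 0 ≤ g 0)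
    (hc : ∀ t, ContinuousWithinAt g (Ici t) t) (T : ℝ≥0∞) :
    stieltjesMeasure (hg.comp (monotone_clip T)) (h0.trans (hg bot_le)) =
      (stieltjesMeasure hg h0).restrict {s | ENNReal.ofReal s ≤ T} := by
  induction T with
  | top => simp [clip_top]
  | coe r =>
    have hset : {s : ℝ | ENNReal.ofReal s ≤ r} = Iic (r : ℝ) := by
      ext s
      simp [ENNReal.ofReal, ← Real.toNNReal_le_iff_le_coe]
    rw [hset]
    simp only [stieltjesMeasure, extendZero_comp_clip_coe]
    exact measure_stieltjes_comp_min_of_rightCont (monotone_extendZero hg h0)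
      (continuousWithinAt_Ici_extendZero (hc r))

theorem stieltjesMeasure_comp_clip_of_leftCont (hg : Monotone g) (h0 : g 0 = 0)
    (hc : ∀ t, ContinuousWithinAt g (Iic t) t) (T : ℝ≥0∞) :
    stieltjesMeasure (hg.comp (monotone_clip T)) (h0.ge.trans (hg bot_le)) =
      (stieltjesMeasure hg h0.ge).restrict {s | 0 ≤ s → ENNReal.ofReal s < T} := by
  induction T with
  | top => simp [clip_top]
  | coe r =>
    have hset : {s : ℝ | 0 ≤ s → ENNReal.ofReal s < r} = Iio (r : ℝ) := by
      ext s
      rcases lt_or_ge s 0 with hs | hs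
      · exact iff_of_true (fun h => absurd h (not_le.2 hs)) (hs.trans_le r.2)
      · lift s to ℝ≥0 using hs
        simp
    rw [hset]
    simp only [stieltjesMeasure, extendZero_comp_clip_coe]
    exact measure_stieltjes_comp_min_of_leftCont (monotone_extendZero hg h0.ge)
      (continuousWithinAt_Iic_extendZero h0 (hc r))

end StoppedStieltjes

section Measurability

variable {Ω : Type*} {mΩ : MeasurableSpace Ω}

theorem measurableSet_of_ae_eq {P : Measure Ω} {m : MeasurableSpace Ω}
    (hm : ∀ s, P s = 0 → MeasurableSet[m] s) {A B : Set Ω} (hA : MeasurableSet[m] A)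
    (hBA : B =ᵐ[P] A) : MeasurableSet[m] B := by
  obtain ⟨hB, hA'⟩ := ae_eq_set.1 hBA
  have hunion : B = A \ (A \ B) ∪ B \ A := by
    rw [sdiff_sdiff_right_self]
    exact (inter_comm A B ▸ inter_union_sdiff B A).symm
  rw [hunion]
  exact (hA.diff (hm _ hA')).union (hm _ hB)

variable {𝓕 : Filtration ℝ≥0 mΩ} {X : ℝ≥0 → Ω → ℝ}

theorem measurable_rightLim_of_lt (hX : ∀ t, Measurable[𝓕 t] (X t))
    (hmono : ∀ ω, Monotone fun t => X t ω) {s t : ℝ≥0} (hst : s < t) :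
    Measurable[𝓕 t] fun ω => Function.rightLim (fun s => X s ω) s := by
  obtain ⟨u, -, hu, hlim⟩ := exists_seq_strictAnti_tendsto' hst
  refine @measurable_of_tendsto_metrizable _ _ (𝓕 t) _ _ _ _ (fun n ω => X (u n) ω) _
    (fun n => (hX (u n)).mono (𝓕.mono (hu n).2.le) le_rfl) (tendsto_pi_nhds.2 fun ω => ?_)
  exact ((hmono ω).tendsto_rightLim s).comp (tendsto_nhdsWithin_of_tendsto_nhds_of_eventually_within
    _ hlim (.of_forall fun n => (hu n).1))

variable {T : Ω → ℝ≥0∞}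

theorem measurable_comp_clip_of_rightCont (hX : ∀ t, Measurable[𝓕 t] (X t))
    (hmono : ∀ ω, Monotone fun t => X t ω)
    (hc : ∀ ω t, ContinuousWithinAt (fun s => X s ω) (Ici t) t)
    (hT : ∀ t : ℝ≥0, MeasurableSet[𝓕 t] {ω | T ω < t}) (t : ℝ≥0) :
    Measurable[𝓕 t] fun ω => X (clip (T ω) t) ω := by
  obtain ⟨D, hDc, hD⟩ := TopologicalSpace.exists_countable_dense ℝ≥0
  refine measurable_of_Iio (mδ := 𝓕 t) fun z => ?_
  have hset : (fun ω => X (clip (T ω) t) ω) ⁻¹' Iio z =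
      {ω | X t ω < z} ∪ ⋃ q ∈ D ∩ Iio t, {ω | T ω < q} ∩ {ω | X q ω < z} := by
    ext ω
    simp only [mem_preimage, mem_Iio, mem_union, mem_ofPred_eq, mem_iUnion, mem_inter_iff,
      exists_prop]
    exact comp_clip_lt_iff (hmono ω) (hc ω) hD
  rw [hset]
  refine (hX t measurableSet_Iio).union (.biUnion (hDc.mono inter_subset_left) fun q hq => ?_)
  exact 𝓕.mono (le_of_lt hq.2) _ ((hT q).inter (hX q measurableSet_Iio))

theorem measurable_comp_clip_of_leftCont (hX : ∀ t, Measurable[𝓕 t] (X t))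
    (hmono : ∀ ω, Monotone fun t => X t ω)
    (hc : ∀ ω t, ContinuousWithinAt (fun s => X s ω) (Iic t) t)
    (hT : ∀ t : ℝ≥0, MeasurableSet[𝓕 t] {ω | T ω < t}) (t : ℝ≥0) :
    Measurable[𝓕 t] fun ω => X (clip (T ω) t) ω := by
  obtain ⟨D, hDc, hD⟩ := TopologicalSpace.exists_countable_dense ℝ≥0
  refine measurable_of_Ioi (mδ := 𝓕 t) fun z => ?_
  have hset : (fun ω => X (clip (T ω) t) ω) ⁻¹' Ioi z =
      ⋃ q ∈ insert 0 (insert t D) ∩ Iic t, {ω | T ω < q}ᶜ ∩ {ω | z < X q ω} := by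
    ext ω
    simp only [mem_preimage, mem_Ioi, mem_ofPred_eq, mem_iUnion, mem_inter_iff, mem_compl_iff,
      not_lt, mem_Iic, exists_prop]
    exact lt_comp_clip_iff (hmono ω) (hc ω) hD
  rw [hset]
  refine .biUnion (((hDc.insert t).insert 0).mono inter_subset_left) fun q hq => ?_
  exact 𝓕.mono hq.2 _ ((hT q).compl.inter (hX q measurableSet_Ioi))

end Measurability

/-! ### Stopping a control at ruin -/

variable {Ω : Type*} [mΩ : MeasurableSpace Ω] {𝓕 : Filtration ℝ≥0 mΩ} {P : Measure Ω}
  {π : Ω → Measure (ℝ≥0 × (ℝ≥0 × ℝ))} {a b η y y' : ℝ}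

/-- The realisation of the claims process `H` at `ω` is a claim path thinned from `π ω`; by
`HawkesClaims.ae_isClaimPathAt` this holds almost surely. -/
abbrev HawkesClaims.IsClaimPathAt (H : HawkesClaims 𝓕 P π a b η y) (ω : Ω) : Prop :=
  IsClaimPath (π ω) a b η y (fun t => H.N t ω) (fun t => H.lam t ω) (fun k => H.Y k ω)

theorem HawkesClaims.ae_isClaimPathAt (H : HawkesClaims 𝓕 P π a b η y) :
    ∀ᵐ ω ∂P, H.IsClaimPathAt ω := by
  filter_upwards [H.counting, H.intensity, H.thinning] with ω hcount hint hthin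
  exact ⟨hcount.1, hcount.2.1, hcount.2.2, fun t => (hint t).1, fun t => (hint t).2, hthin⟩

theorem IsClaimPath.continuousWithinAt_sum_claims {μ : Measure (ℝ≥0 × (ℝ≥0 × ℝ))} {N : ℝ≥0 → ℕ}
    {l : ℝ≥0 → ℝ} {Y : ℕ → ℝ} (h : IsClaimPath μ a b η y N l Y) (t : ℝ≥0) :
    ContinuousWithinAt (fun s => ∑ k ∈ Finset.range (N s), Y k) (Ici t) t :=
  (continuous_of_discreteTopology (f := fun n => ∑ k ∈ Finset.range n, Y k)).continuousAt
    |>.comp_continuousWithinAt (h.rightCont t)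

theorem IsClaimPath.exists_tendsto_sum_claims {μ : Measure (ℝ≥0 × (ℝ≥0 × ℝ))} {N : ℝ≥0 → ℕ}
    {l : ℝ≥0 → ℝ} {Y : ℕ → ℝ} (h : IsClaimPath μ a b η y N l Y) {t : ℝ≥0} (ht : 0 < t) :
    ∃ L, Tendsto (fun s => ∑ k ∈ Finset.range (N s), Y k) (𝓝[<] t) (𝓝 L) := by
  obtain ⟨n, hn⟩ := eventually_nhdsLT_eq_of_monotone_nat h.mono ⟨0, ht⟩
  refine ⟨∑ k ∈ Finset.range n, Y k, tendsto_const_nhds.congr' ?_⟩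
  filter_upwards [hn] with s hs
  rw [hs]

theorem HawkesClaims.reserve_eq_add (H : HawkesClaims 𝓕 P π a b η y) (c x : ℝ) (t : ℝ≥0) (ω : Ω) :
    H.reserve c x t ω = x + H.reserve c 0 t ω := by
  simp only [HawkesClaims.reserve, zero_add, add_sub_assoc]

namespace Control

section Paths

variable {α : Control 𝓕} {H : HawkesClaims 𝓕 P π a b η y} {ω : Ω} (h : H.IsClaimPathAt ω)
  (c x : ℝ) (t : ℝ≥0)

include h

theorem tendsto_surplus_nhdsGT : Tendsto (fun s => α.surplus H c x s ω) (𝓝[>] t)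
    (𝓝 (H.reserve c x t ω - α.Z t ω + Function.rightLim (fun s => α.K s ω) t)) := by
  have hIci : 𝓝[>] t ≤ 𝓝[≥] t := nhdsWithin_mono _ Ioi_subset_Ici_self
  have hpremium : Continuous fun s : ℝ≥0 => x + c * (s : ℝ) := by fun_prop
  have hreserve : ContinuousWithinAt (fun s => H.reserve c x s ω) (Ici t) t :=
    hpremium.continuousWithinAt.sub (h.continuousWithinAt_sum_claims t)
  exact ((hreserve.sub (α.rightCont_Z ω t)).mono_left hIci).add ((α.mono_K ω).tendsto_rightLim t)

theorem rightLim_surplus : Function.rightLim (fun s => α.surplus H c x s ω) t =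
    H.reserve c x t ω - α.Z t ω + Function.rightLim (fun s => α.K s ω) t :=
  rightLim_eq_of_tendsto (tendsto_surplus_nhdsGT h c x t)

theorem preVal_surplus_add_jump :
    preVal x (fun s => α.surplus H c x s ω) t +
      (H.reserve c 0 t ω - preVal 0 (fun s => H.reserve c 0 s ω) t) =
    H.reserve c x t ω - preVal 0 (fun s => α.Z s ω) t + preVal 0 (fun s => α.K s ω) t := by
  rw [H.reserve_eq_add c x t]
  rcases eq_or_ne t 0 with rfl | ht
  · simp only [preVal, if_true]
    ring
  · have ht' : 0 < t := pos_iff_ne_zero.2 ht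
    have : (𝓝[<] t).NeBot := nhdsLT_neBot_of_exists_lt ⟨0, ht'⟩
    obtain ⟨L, hL⟩ := h.exists_tendsto_sum_claims ht'
    have hpremium : Continuous fun s : ℝ≥0 => c * (s : ℝ) := by fun_prop
    have hreserve : ∀ x : ℝ, Tendsto (fun s => H.reserve c x s ω) (𝓝[<] t) (𝓝 (x + c * t - L)) :=
      fun x => (((hpremium.tendsto t).mono_left nhdsWithin_le_nhds).const_add x).sub hL
    have hsurplus : Tendsto (fun s => α.surplus H c x s ω) (𝓝[<] t) _ :=
      ((hreserve x).sub ((α.mono_Z ω).tendsto_leftLim t)).add ((α.mono_K ω).tendsto_leftLim t)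
    simp only [preVal, if_neg ht]
    rw [leftLim_eq_of_tendsto hsurplus, leftLim_eq_of_tendsto (hreserve 0)]
    ring

theorem ruinTime_lt_iff {D : Set ℝ≥0} (hD : Dense D) : α.ruinTime H c x ω < t ↔
    ∃ q ∈ D ∩ Iio t, Function.rightLim (fun s => α.surplus H c x s ω) q < 0 := by
  simp only [ruinTime, iInf_lt_iff, ENNReal.coe_lt_coe]
  constructor
  · rintro ⟨s, hruin, hst⟩
    have hright := continuousWithinAt_rightLim_Ici
      (tendsto_rightLim_of_tendsto ⟨_, tendsto_surplus_nhdsGT (α := α) h c x s⟩)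
    obtain ⟨q, hqD, -, hqt, hq⟩ := exists_mem_dense_of_eventually_nhdsGT hD hst
      ((hright.mono_left (nhdsWithin_mono s Ioi_subset_Ici_self)).eventually_lt_const hruin)
    exact ⟨q, ⟨hqD, hqt⟩, hq⟩
  · rintro ⟨q, ⟨-, hqt⟩, hq⟩
    exact ⟨q, hq, hqt⟩

end Paths

theorem measurableSet_ruinTime_lt (h𝓕 : ∀ s, P s = 0 → MeasurableSet[𝓕 0] s) (α : Control 𝓕)
    (H : HawkesClaims 𝓕 P π a b η y) (c x : ℝ) (t : ℝ≥0) :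
    MeasurableSet[𝓕 t] {ω | α.ruinTime H c x ω < t} := by
  obtain ⟨D, hDc, hD⟩ := TopologicalSpace.exists_countable_dense ℝ≥0
  have hmeas : MeasurableSet[𝓕 t] (⋃ q ∈ D ∩ Iio t, {ω | H.reserve c x q ω - α.Z q ω +
      Function.rightLim (fun s => α.K s ω) q < 0}) := by
    refine .biUnion (hDc.mono inter_subset_left) fun q hq => ?_
    have hRZ : Measurable[𝓕 q] fun ω => H.reserve c x q ω - α.Z q ω :=
      ((H.adapted_claims q).const_sub (x + c * q)).sub (α.adapted_Z q)
    exact ((hRZ.mono (𝓕.mono (le_of_lt hq.2)) le_rfl).add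
      (measurable_rightLim_of_lt α.adapted_K α.mono_K hq.2)) measurableSet_Iio
  refine measurableSet_of_ae_eq (fun s hs => 𝓕.mono bot_le s (h𝓕 s hs)) hmeas ?_
  refine Filter.eventuallyEq_set.2 ?_
  filter_upwards [H.ae_isClaimPathAt] with ω hω
  simp only [mem_ofPred_eq, ruinTime_lt_iff hω c x t hD, rightLim_surplus hω, mem_iUnion,
    exists_prop]

/-- The control `α` stopped at the random time `T`, after which it pays neither dividends nor
injections. Ruin is detected to the right of `T`, so only `{T < t}`, not `{T ≤ t}`, is assumed to
be known at time `t`. -/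
noncomputable def stopped (α : Control 𝓕) {T : Ω → ℝ≥0∞}
    (hT : ∀ t : ℝ≥0, MeasurableSet[𝓕 t] {ω | T ω < t}) : Control 𝓕 where
  Z t ω := α.Z (clip (T ω) t) ω
  K t ω := α.K (clip (T ω) t) ω
  adapted_Z := measurable_comp_clip_of_rightCont α.adapted_Z α.mono_Z α.rightCont_Z hT
  adapted_K := measurable_comp_clip_of_leftCont α.adapted_K α.mono_K α.leftCont_K hT
  mono_Z ω := (α.mono_Z ω).comp (monotone_clip _)
  mono_K ω := (α.mono_K ω).comp (monotone_clip _)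
  rightCont_Z ω t := (α.rightCont_Z ω _).comp (continuous_clip (T ω)).continuousWithinAt
    fun _ hs => monotone_clip _ hs
  leftCont_K ω t := (α.leftCont_K ω _).comp (continuous_clip (T ω)).continuousWithinAt
    fun _ hs => monotone_clip _ hs
  zero_le_Z ω := (α.zero_le_Z ω).trans (α.mono_Z ω bot_le)
  K_zero ω := by rw [clip_of_le bot_le, α.K_zero]

section Stopped

variable {α : Control 𝓕} {T : Ω → ℝ≥0∞} (hT : ∀ t : ℝ≥0, MeasurableSet[𝓕 t] {ω | T ω < t})
  {H : HawkesClaims 𝓕 P π a b η y} {H' : HawkesClaims 𝓕 P π a b η y'} {c x : ℝ} {ω : Ω}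

theorem Admissible.stopped (hα : α.Admissible H' c x)
    (hR : ∀ᵐ ω ∂P, ∀ t, H'.reserve c x t ω ≤ H.reserve c x t ω) :
    (α.stopped hT).Admissible H c x := by
  filter_upwards [hα, hR, H.ae_isClaimPathAt, H'.ae_isClaimPathAt] with ω hω hRω h h' t
  have hωt := hω t
  rw [preVal_surplus_add_jump h'] at hωt
  rw [preVal_surplus_add_jump h]
  rcases le_or_gt (t : ℝ≥0∞) (T ω) with hle | hlt
  · have hZ : preVal 0 (fun s => (α.stopped hT).Z s ω) t = preVal 0 (fun s => α.Z s ω) t :=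
      preVal_comp_clip_of_le (α.mono_Z ω) 0 hle
    have hK : preVal 0 (fun s => (α.stopped hT).K s ω) t = preVal 0 (fun s => α.K s ω) t :=
      preVal_comp_clip_of_le (α.mono_K ω) 0 hle
    have hZt : (α.stopped hT).Z t ω = α.Z t ω := congrArg (α.Z · ω) (clip_of_le hle)
    rw [hZ, hK, hZt]
    refine hωt.trans (max_le_max_left 0 ?_)
    gcongr
    exact hRω t
  · have hZ : preVal 0 (fun s => (α.stopped hT).Z s ω) t = α.Z (T ω).toNNReal ω :=
      preVal_comp_clip_of_gt (fun s => α.Z s ω) 0 hlt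
    have hZt : (α.stopped hT).Z t ω = α.Z (T ω).toNNReal ω :=
      congrArg (α.Z · ω) (clip_of_ge hlt.le)
    rw [hZ, hZt, sub_self]
    exact le_max_left _ _

theorem le_ruinTime_stopped (h : H.IsClaimPathAt ω) (h' : H'.IsClaimPathAt ω)
    (hTω : T ω ≤ α.ruinTime H' c x ω) (hR : ∀ t, H'.reserve c x t ω ≤ H.reserve c x t ω) :
    T ω ≤ (α.stopped hT).ruinTime H c x ω := by
  refine le_iInf₂ fun t ht => ?_
  by_contra! hlt
  refine (hlt.trans_le hTω).not_ge (iInf₂_le t ?_)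
  rw [rightLim_surplus h] at ht
  rw [rightLim_surplus h']
  have hZ : (α.stopped hT).Z t ω = α.Z t ω := congrArg (α.Z · ω) (clip_of_le hlt.le)
  have hK : Function.rightLim (fun s => (α.stopped hT).K s ω) t =
      Function.rightLim (fun s => α.K s ω) t := rightLim_comp_clip_of_lt (α.mono_K ω) hlt
  rw [hZ, hK] at ht
  linarith [hR t]

theorem discountedDividends_le_stopped (hTω : α.ruinTime H' c x ω ≤ T ω)
    (hle : α.ruinTime H' c x ω ≤ (α.stopped hT).ruinTime H c x ω) (ρ : ℝ) :
    α.discountedDividends H' c ρ x ω ≤ (α.stopped hT).discountedDividends H c ρ x ω := by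
  have hm : MeasurableSet {s : ℝ | 0 ≤ s ∧
      ENNReal.ofReal s ≤ (α.stopped hT).ruinTime H c x ω} :=
    measurableSet_Ici.inter (ENNReal.measurable_ofReal measurableSet_Iic)
  have hmeasure : stieltjesMeasure ((α.stopped hT).mono_Z ω) ((α.stopped hT).zero_le_Z ω) =
      (stieltjesMeasure (α.mono_Z ω) (α.zero_le_Z ω)).restrict {s | ENNReal.ofReal s ≤ T ω} :=
    stieltjesMeasure_comp_clip_of_rightCont (α.mono_Z ω) (α.zero_le_Z ω) (α.rightCont_Z ω) (T ω)
  rw [discountedDividends, discountedDividends, hmeasure, Measure.restrict_restrict hm]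
  exact lintegral_mono_set fun s hs => ⟨⟨hs.1, hs.2.trans hle⟩, hs.2.trans hTω⟩

theorem discountedInjections_stopped_le (hTω : T ω ≤ α.ruinTime H' c x ω) (ρ : ℝ) :
    (α.stopped hT).discountedInjections H c ρ x ω ≤ α.discountedInjections H' c ρ x ω := by
  have hm : MeasurableSet {s : ℝ | 0 ≤ s ∧
      ENNReal.ofReal s < (α.stopped hT).ruinTime H c x ω} :=
    measurableSet_Ici.inter (ENNReal.measurable_ofReal measurableSet_Iio)
  have hmeasure : stieltjesMeasure ((α.stopped hT).mono_K ω) ((α.stopped hT).K_zero ω).ge =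
      (stieltjesMeasure (α.mono_K ω) (α.K_zero ω).ge).restrict
        {s | 0 ≤ s → ENNReal.ofReal s < T ω} :=
    stieltjesMeasure_comp_clip_of_leftCont (α.mono_K ω) (α.K_zero ω) (α.leftCont_K ω) (T ω)
  rw [discountedInjections, discountedInjections, hmeasure, Measure.restrict_restrict hm]
  exact lintegral_mono_set fun s hs => ⟨hs.1.1, (hs.2 hs.1.1).trans_le hTω⟩

end Stopped

theorem reward_le_reward_stopped (h𝓕 : ∀ s, P s = 0 → MeasurableSet[𝓕 0] s) (α : Control 𝓕)
    {H : HawkesClaims 𝓕 P π a b η y} {H' : HawkesClaims 𝓕 P π a b η y'} {c x : ℝ}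
    (hR : ∀ᵐ ω ∂P, ∀ t, H'.reserve c x t ω ≤ H.reserve c x t ω) (ρ δ : ℝ) :
    α.reward H' c ρ δ x ≤
      (α.stopped (α.measurableSet_ruinTime_lt h𝓕 H' c x)).reward H c ρ δ x := by
  refine EReal.sub_le_sub (EReal.coe_ennreal_le_coe_ennreal_iff.2 ?_)
    (EReal.coe_ennreal_le_coe_ennreal_iff.2 ?_)
  · refine lintegral_mono_ae ?_
    filter_upwards [hR, H.ae_isClaimPathAt, H'.ae_isClaimPathAt] with ω hω h h'
    exact discountedDividends_le_stopped _ le_rfl (le_ruinTime_stopped _ h h' le_rfl hω) ρ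
  · gcongr with ω
    exact discountedInjections_stopped_le _ le_rfl ρ

end Control

theorem valueFunction_le_of_reserve_le (h𝓕 : ∀ s, P s = 0 → MeasurableSet[𝓕 0] s)
    {H : HawkesClaims 𝓕 P π a b η y} {H' : HawkesClaims 𝓕 P π a b η y'} {c x : ℝ}
    (hR : ∀ᵐ ω ∂P, ∀ t, H'.reserve c x t ω ≤ H.reserve c x t ω) (ρ δ : ℝ) :
    valueFunction H' c ρ δ x ≤ valueFunction H c ρ δ x :=
  iSup₂_le fun α hα => (α.reward_le_reward_stopped h𝓕 hR ρ δ).trans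
    (le_iSup₂ (f := fun α (_ : Control.Admissible α H c x) => α.reward H c ρ δ x) _
      (hα.stopped (α.measurableSet_ruinTime_lt h𝓕 H' c x) hR))

end HawkesDividend

open HawkesDividend in
theorem mainTheorem6_general {Ω : Type*} [mΩ : MeasurableSpace Ω] {P : Measure Ω}
    {𝓕 : Filtration ℝ≥0 mΩ} (h𝓕 : ∀ s : Set Ω, P s = 0 → MeasurableSet[𝓕 0] s)
    {π : Ω → Measure (ℝ≥0 × (ℝ≥0 × ℝ))} (hπ : ∀ᵐ ω ∂P, π ω {p | p.2.2 < 0} = 0)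
    {a b η y y' : ℝ} (hη : 0 ≤ η) (hy : y ≤ y')
    (H : HawkesClaims 𝓕 P π a b η y) (H' : HawkesClaims 𝓕 P π a b η y')
    (c ρ : ℝ) (δ : ℝ≥0) (x : ℝ) :
    valueFunction H' c ρ δ x ≤ valueFunction H c ρ δ x := by
  refine valueFunction_le_of_reserve_le h𝓕 ?_ ρ δ
  filter_upwards [H.ae_isClaimPathAt, H'.ae_isClaimPathAt, hπ] with ω h h' hμ t
  exact sub_le_sub_left (h.sum_claims_le h' hη hy hμ t) _

open HawkesDividend in
theorem mainTheorem6 {Ω : Type*} [mΩ : MeasurableSpace Ω]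
    (P : Measure Ω) [IsProbabilityMeasure P]
    (𝓕 : Filtration ℝ≥0 mΩ) (h𝓕 : UsualConditions 𝓕 P)
    (a b η c ρ δ : ℝ) (ha : 0 < a) (hb : 0 < b) (hη : 0 < η) (hc : 0 < c) (hρ : 0 < ρ)
    (hδ : 1 < δ)
    (f : ℝ → ℝ) (hf : IsPositiveDensity f)
    (π : Ω → Measure (ℝ≥0 × (ℝ≥0 × ℝ)))
    (hπ : IsPoissonRandomMeasure 𝓕 P (claimIntensity f) π)
    (H : ∀ y : Set.Ici b, HawkesClaims 𝓕 P π a b η (y : ℝ))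
    (x : ℝ) (hx : 0 ≤ x) :
    Antitone fun y : Set.Ici b => valueFunction (H y) c ρ δ x := by
  intro y y' hy
  have hmeas : MeasurableSet {p : ℝ≥0 × (ℝ≥0 × ℝ) | p.2.2 < 0} :=
    measurableSet_lt (by fun_prop) (by fun_prop)
  exact mainTheorem6_general h𝓕.complete
    (hπ.ae_eq_zero hmeas (claimIntensity_neg fun z hz => hf.eq_zero z hz.le)) hη.le hy (H y) (H y')
    c ρ ⟨δ, zero_le_one.trans hδ.le⟩ x
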